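/- Let $\mathbb{K}$ be $\mathbb{R}$ or $\mathbb{C}$. For $q\in(0,\infty]$ and a Banach space $E$ over $\mathbb{K}$, let $\ell_q(E)$ be the space of sequences $(x_j)_{j\ge 1}$ in $E$ with $\sum_j\|x_j\|^q<\infty$ (bounded sequences if $q=\infty$), and let $\ell_q^w(E)$ be the space of sequences $(x_j)_{j\ge1}$ in $E$ such that $(\varphi(x_j))_j\in\ell_q(\mathbb{K})$ for every continuous linear functional $\varphi:E\to\mathbb{K}$. A continuous $n$-linear mapping $T:E_1\times\dots\times E_n\to F$ between Banach spaces is \emph{$(p;q_1,\dots,q_n)$-summing at} $(a_1,\dots,a_n)\in E_1\times\dots\times E_n$ if $$\bigl(T(a_1+x^{(1)}_j,\dots,a_n+x^{(n)}_j)-T(a_1,\dots,a_n)\bigr)_{j\ge1}\in\ell_p(F)$$ whenever $(x^{(s)}_j)_{j\ge1}\in\ell^w_{q_s}(E_s)$ for $s=1,\dots,n$. A Banach space $X$ is an \emph{$\mathcal{L}_\infty$ space} if there is $\lambda>1$ such that every finite-dimensional subspace $E$ of $X$ is contained in a finite-dimensional subspace $F$ of $X$ admitting an isomorphism $v:F\to\ell_\infty^{\dim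 F}$ with $\|v\|\,\|v^{-1}\|<\lambda$. \textbf{Theorem.} Let $X_1,\dots,X_n$ be $\mathcal{L}_\infty$ spaces over $\mathbb{K}$ and let $T:X_1\times\dots\times X_n\to\mathbb{K}$ be a continuous $n$-linear mapping. (1) If $n=2$, then $T$ is $(r;r,r)$-summing at every point of $X_1\times X_2$, for every $r\in[2,\infty]$. (2) If $n\ge3$, then $T$ is $(r;2,\dots,2,r)$-summing at every point of $X_1\times\dots\times X_n$, for every $r\in[2,\infty]$. -/

import Mathlib

open scoped ENNReal

/-- `X` is an `𝓛_{∞,lam}` space: every finite dimensional subspace `E` of `X` is contained in a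
finite dimensional subspace `F` with an isomorphism `v` from `F` onto `ℓ_∞^{dim F}`
(that is `Fin (dim F) → 𝕜` with the sup norm) such that `‖v‖ * ‖v⁻¹‖ < lam`. -/
def IsScriptLInftyWith (𝕜 : Type*) [RCLike 𝕜] (X : Type*) [NormedAddCommGroup X]
    [NormedSpace 𝕜 X] (lam : ℝ) : Prop :=
  ∀ E : Submodule 𝕜 X, FiniteDimensional 𝕜 E →
    ∃ F : Submodule 𝕜 X, E ≤ F ∧ FiniteDimensional 𝕜 F ∧
      ∃ v : F ≃L[𝕜] (Fin (Module.finrank 𝕜 F) → 𝕜),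
        ‖(v : F →L[𝕜] (Fin (Module.finrank 𝕜 F) → 𝕜))‖ *
          ‖(v.symm : (Fin (Module.finrank 𝕜 F) → 𝕜) →L[𝕜] F)‖ < lam

/-- `X` is an `𝓛_∞` space if it is an `𝓛_{∞,lam}` space for some `lam > 1`. -/
def IsScriptLInfty (𝕜 : Type*) [RCLike 𝕜] (X : Type*) [NormedAddCommGroup X]
    [NormedSpace 𝕜 X] : Prop :=
  ∃ lam : ℝ, 1 < lam ∧ IsScriptLInftyWith 𝕜 X lam

/-- The sequence `x` belongs to `ℓ_q^w(E)`: it is weakly `q`-summable, i.e. `(φ (x j))_j` lies in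
`ℓ_q` for every continuous linear functional `φ` (for `q = ∞`: is bounded). -/
def IsWeaklySummable (𝕜 : Type*) [RCLike 𝕜] {E : Type*} [NormedAddCommGroup E]
    [NormedSpace 𝕜 E] (q : ℝ≥0∞) (x : ℕ → E) : Prop :=
  ∀ φ : E →L[𝕜] 𝕜, Memℓp (E := fun _ : ℕ => 𝕜) (fun j => φ (x j)) q

/-- The continuous multilinear map `T` is absolutely `(p; q₁, …, qₙ)`-summing at the point `a`
(exponents in `(0, ∞]`). -/
def IsAbsSummingAt {𝕜 : Type*} [RCLike 𝕜] {ι : Type*} {E : ι → Type*}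
    [∀ i, NormedAddCommGroup (E i)] [∀ i, NormedSpace 𝕜 (E i)]
    {F : Type*} [NormedAddCommGroup F] [NormedSpace 𝕜 F]
    (p : ℝ≥0∞) (q : ι → ℝ≥0∞) (T : ContinuousMultilinearMap 𝕜 E F) (a : ∀ i, E i) : Prop :=
  ∀ x : (i : ι) → ℕ → E i, (∀ i, IsWeaklySummable 𝕜 (q i) (x i)) →
    Memℓp (E := fun _ : ℕ => F) (fun j => T (fun i => a i + x i j) - T a) p

/-! Expanding T(a + x_j) - T(a) by multilinearity leaves terms in which a nonempty set S of slots
carries x_j and the other slots carry a; each such sequence must lie in ℓ_r. Everything rests on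
Grothendieck's inequality, which passes to 𝓛_∞ spaces because finitely many vectors lie in a
uniformly isomorphic copy of some ℓ_∞^N. It yields two facts: |∑ T(x_j, y_j)| is controlled by the
weak ℓ_2 norms of x and y (`norm_sum_bilin_le`), and bounded operators into a finite-dimensional
Hilbert space are 2-summing with a dimension-free constant (`sum_sum_norm_sq_le`). Pietsch's
inclusion argument lifts 2 to any finite p ≥ 2.

For n = 2, replacing y_j by suitable scalar multiples shows that (T(x_j, y_j)) is p-summable when x
is weakly p-summable and y is merely bounded. This treats every S at once, since y_j may be either a
moving or a fixed vector.

For n ≥ 3, induction on the number of slots makes z ↦ (T(x_k, z))_k, with k running over all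
multi-indices of the first slots, a bounded operator from the last space into ℓ_2. If the last slot
moves, this operator is r-summing and each required term is one of its coordinates; if it is fixed
at a, the required sum is a subsum of a single ℓ_2 sum. For r = ∞ only boundedness is needed. -/

/-! ### Grothendieck's inequality by truncation of Rademacher sums -/

section Grothendieck

variable {𝕜 : Type*} [RCLike 𝕜]

/-- With A = ‖g + c‖² and B = ‖g - c‖², use 2(A² + B²) = (A + B)² + (A - B)²: the parallelogram law
gives A + B, and |A - B| ≤ 4‖g‖‖c‖. This is the induction step for fourth moments of Rademacher
sums. -/
theorem norm_add_pow_four_add_norm_sub_pow_four_le (g c : 𝕜) :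
    ‖g + c‖ ^ 4 + ‖g - c‖ ^ 4 ≤ 2 * (‖g‖ ^ 4 + 6 * ‖g‖ ^ 2 * ‖c‖ ^ 2 + ‖c‖ ^ 4) := by
  have h := parallelogram_law_with_norm 𝕜 g c
  have h1 : ‖g + c‖ ^ 2 ≤ (‖g‖ + ‖c‖) ^ 2 := by gcongr; exact norm_add_le g c
  have h2 : ‖g - c‖ ^ 2 ≤ (‖g‖ + ‖c‖) ^ 2 := by gcongr; exact norm_sub_le g c
  have h3 : (‖g + c‖ ^ 2 - ‖g - c‖ ^ 2) ^ 2 ≤ (4 * (‖g‖ * ‖c‖)) ^ 2 := by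
    apply sq_le_sq' <;> nlinarith
  have h4 : (‖g + c‖ ^ 2 + ‖g - c‖ ^ 2) ^ 2 = (2 * (‖g‖ ^ 2 + ‖c‖ ^ 2)) ^ 2 := by
    linear_combination (‖g + c‖ ^ 2 + ‖g - c‖ ^ 2 + 2 * (‖g‖ ^ 2 + ‖c‖ ^ 2)) * h
  nlinarith

/-- Existence of a finite Rademacher system of length `d`. -/
theorem exists_rademacher_system (𝕜 : Type*) [RCLike 𝕜] (d : ℕ) :
    ∃ (Ω : Type) (_ : Fintype Ω) (_ : Nonempty Ω) (ε : Fin d → Ω → 𝕜),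
      (∀ x y : Fin d → 𝕜, ∑ ω, (∑ j, x j * ε j ω) * (∑ j, y j * ε j ω) =
        (Fintype.card Ω : 𝕜) * ∑ j, x j * y j) ∧
      (∀ x : Fin d → 𝕜, ∑ ω, ‖∑ j, x j * ε j ω‖ ^ 2 =
        (Fintype.card Ω : ℝ) * ∑ j, ‖x j‖ ^ 2) ∧
      (∀ x : Fin d → 𝕜, ∑ ω, ‖∑ j, x j * ε j ω‖ ^ 4 ≤
        3 * (Fintype.card Ω : ℝ) * (∑ j, ‖x j‖ ^ 2) ^ 2) := by
  induction d with
  | zero => exact ⟨Unit, inferInstance, inferInstance, fun _ _ => 0, by simp, by simp, by simp⟩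
  | succ d ih =>
    obtain ⟨Ω, _, _, ε, h1, h2, h4⟩ := ih
    refine ⟨Ω × Bool, inferInstance, inferInstance,
      Fin.cons (fun p => if p.2 then 1 else -1) (fun j p => ε j p.1), ?_, ?_, ?_⟩
    · intro x y
      simp only [Fintype.sum_prod_type, Fintype.sum_bool, Fin.sum_univ_succ, Fin.cons_zero,
        Fin.cons_succ, Fintype.card_prod, Fintype.card_bool, if_true, Bool.false_eq_true,
        if_false, mul_one, mul_neg]
      have : ∀ ω, (x 0 + ∑ j : Fin d, x j.succ * ε j ω) *
            (y 0 + ∑ j : Fin d, y j.succ * ε j ω) +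
          (-x 0 + ∑ j : Fin d, x j.succ * ε j ω) *
            (-y 0 + ∑ j : Fin d, y j.succ * ε j ω) =
          2 * (x 0 * y 0) +
            2 * ((∑ j : Fin d, x j.succ * ε j ω) * ∑ j : Fin d, y j.succ * ε j ω) := by
        intro ω
        ring
      rw [Finset.sum_congr rfl fun ω _ => this ω, Finset.sum_add_distrib, Finset.sum_const, ← Finset.mul_sum,
        h1 (fun j => x j.succ) (fun j => y j.succ)]
      simp only [Finset.card_univ, nsmul_eq_mul]
      push_cast
      ring
    · intro x
      simp only [Fintype.sum_prod_type, Fintype.sum_bool, Fin.sum_univ_succ, Fin.cons_zero,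
        Fin.cons_succ, Fintype.card_prod, Fintype.card_bool, if_true, Bool.false_eq_true,
        if_false, mul_one, mul_neg]
      have : ∀ ω, ‖x 0 +
            ∑ j : Fin d, x j.succ * ε j ω‖ ^ 2 +
          ‖-x 0 + ∑ j : Fin d, x j.succ * ε j ω‖ ^ 2 =
          2 * ‖x 0‖ ^ 2 + 2 * ‖∑ j : Fin d, x j.succ * ε j ω‖ ^ 2 := by
        intro ω
        have := parallelogram_law_with_norm 𝕜 (∑ j : Fin d, x j.succ * ε j ω) (x 0)
        rw [add_comm (x 0), neg_add_eq_sub]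
        linarith
      rw [Finset.sum_congr rfl fun ω _ => this ω, Finset.sum_add_distrib, ← Finset.mul_sum,
        ← Finset.mul_sum, h2 (fun j => x j.succ)]
      simp only [Finset.sum_const, Finset.card_univ, nsmul_eq_mul]
      push_cast
      ring
    · intro x
      simp only [Fintype.sum_prod_type, Fintype.sum_bool, Fin.sum_univ_succ, Fin.cons_zero,
        Fin.cons_succ, Fintype.card_prod, Fintype.card_bool, if_true, Bool.false_eq_true,
        if_false, mul_one, mul_neg]
      have : ∀ ω, ‖x 0 +
            ∑ j : Fin d, x j.succ * ε j ω‖ ^ 4 +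
          ‖-x 0 + ∑ j : Fin d, x j.succ * ε j ω‖ ^ 4 ≤
          2 * ‖x 0‖ ^ 4 + 2 * ‖∑ j : Fin d, x j.succ * ε j ω‖ ^ 4 +
            (12 * ‖x 0‖ ^ 2) * ‖∑ j : Fin d, x j.succ * ε j ω‖ ^ 2 := by
        intro ω
        have := norm_add_pow_four_add_norm_sub_pow_four_le
          (∑ j : Fin d, x j.succ * ε j ω) (x 0)
        rw [add_comm (x 0), neg_add_eq_sub]
        linarith
      refine (Finset.sum_le_sum fun ω _ => this ω).trans ?_
      rw [Finset.sum_add_distrib, Finset.sum_add_distrib, ← Finset.mul_sum,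
        ← Finset.mul_sum, ← Finset.mul_sum, h2 (fun j => x j.succ)]
      have h4' := h4 (fun j => x j.succ)
      simp only [Finset.sum_const, Finset.card_univ, nsmul_eq_mul]
      push_cast
      -- With a = ‖x 0‖² and b the remaining sum of squares, the bound obtained is 2a² + 12ab + 6b²
      -- per point of Ω, against the target 6(a + b)²; the slack is 4a².
      have : 0 ≤ (Fintype.card Ω : ℝ) * ‖x 0‖ ^ 4 := by positivity
      nlinarith

/-- Square integrable vectors embed into a finite probability space in such a way that each of them
is a bounded function up to a small error. -/
theorem exists_truncated_embedding (𝕜 : Type*) [RCLike 𝕜] (J : Type*) [Fintype J] :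
    ∃ (Ω : Type) (_ : Fintype Ω) (_ : Nonempty Ω) (G : (J → 𝕜) → Ω → 𝕜),
      (∀ x y : J → 𝕜, ∑ ω, G x ω * G y ω = (Fintype.card Ω : 𝕜) * ∑ j, x j * y j) ∧
      ∀ (x : J → 𝕜) (α : ℝ), 0 < α → ∑ j, ‖x j‖ ^ 2 ≤ α ^ 2 →
        ∑ ω, ‖G x ω‖ ^ 2 ≤ (Fintype.card Ω : ℝ) * α ^ 2 ∧
        ∃ f g : Ω → 𝕜, (∀ ω, G x ω = f ω + g ω) ∧ (∀ ω, ‖f ω‖ ≤ 6 * α) ∧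
          ∑ ω, ‖f ω‖ ^ 2 ≤ (Fintype.card Ω : ℝ) * α ^ 2 ∧
          ∑ ω, ‖g ω‖ ^ 2 ≤ (Fintype.card Ω : ℝ) * (α / 3) ^ 2 := by
  obtain ⟨Ω, _, _, ε, h1, h2, h4⟩ := exists_rademacher_system 𝕜 (Fintype.card J)
  let e := (Fintype.equivFin J).symm
  refine ⟨Ω, inferInstance, inferInstance, fun x ω => ∑ j, x (e j) * ε j ω, ?_, ?_⟩
  · intro x y
    rw [h1 (fun j => x (e j)) (fun j => y (e j)), Equiv.sum_comp e fun j => x j * y j]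
  · intro x α hα hx
    have hx' : ∑ j, ‖x (e j)‖ ^ 2 ≤ α ^ 2 := by
      rwa [Equiv.sum_comp e fun j => ‖x j‖ ^ 2]
    replace h2 := h2 (fun j => x (e j))
    replace h4 := h4 (fun j => x (e j))
    obtain ⟨F, hF⟩ : ∃ F : Ω → 𝕜, ∀ ω, ∑ j, x (e j) * ε j ω = F ω := ⟨_, fun _ => rfl⟩
    simp only [hF] at h2 h4 ⊢
    have hs : ∑ ω, ‖F ω‖ ^ 2 ≤ (Fintype.card Ω : ℝ) * α ^ 2 := by
      rw [h2]; gcongr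
    refine ⟨hs, fun ω => if ‖F ω‖ ≤ 6 * α then F ω else 0,
      fun ω => if ‖F ω‖ ≤ 6 * α then 0 else F ω, ?_, ?_, ?_, ?_⟩
    · intro ω; dsimp only; split_ifs <;> simp
    · intro ω
      dsimp only
      split_ifs with h
      · exact h
      · simp; positivity
    · refine (Finset.sum_le_sum fun ω _ => ?_).trans hs
      dsimp only
      split_ifs
      · exact le_rfl
      · simp
    -- Chebyshev with the fourth moment: the tail has mean square at most 3α⁴ / (36α²) = α²/12,
    -- below (α/3)².
    · have h36 : ∀ ω, ‖(if ‖F ω‖ ≤ 6 * α then 0 else F ω)‖ ^ 2 ≤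
          ‖F ω‖ ^ 4 * (36 * α ^ 2)⁻¹ := by
        intro ω
        split_ifs with h
        · simp; positivity
        · rw [← div_eq_mul_inv, le_div_iff₀ (by positivity)]
          have : (6 * α) ^ 2 ≤ ‖F ω‖ ^ 2 := by gcongr; exact (not_le.1 h).le
          nlinarith [sq_nonneg ‖F ω‖]
      refine (Finset.sum_le_sum fun ω _ => h36 ω).trans ?_
      rw [← Finset.sum_mul, ← div_eq_mul_inv, div_le_iff₀ (by positivity)]
      refine h4.trans ?_
      have h0 : (∑ j, ‖x (e j)‖ ^ 2) ^ 2 ≤ (α ^ 2) ^ 2 := by gcongr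
      have hc : (0 : ℝ) ≤ Fintype.card Ω := by positivity
      calc 3 * (Fintype.card Ω : ℝ) * (∑ j, ‖x (e j)‖ ^ 2) ^ 2
          ≤ 3 * (Fintype.card Ω : ℝ) * (α ^ 2) ^ 2 := by gcongr
        _ ≤ (Fintype.card Ω : ℝ) * (α / 3) ^ 2 * (36 * α ^ 2) := by
          have : 0 ≤ (Fintype.card Ω : ℝ) * (α ^ 2) ^ 2 := by positivity
          nlinarith

variable {M N : Type*} [Fintype M] [Fintype N]

/-- `K` bounds the form with matrix `a` on vectors of Euclidean spaces in place of scalars. -/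
def IsGrothendieckBound (a : M → N → 𝕜) (K : ℝ) : Prop :=
  ∀ (J : Type) [Fintype J] (x : M → J → 𝕜) (y : N → J → 𝕜) (α β : ℝ), 0 < α → 0 < β →
    (∀ m, ∑ j, ‖x m j‖ ^ 2 ≤ α ^ 2) → (∀ n, ∑ j, ‖y n j‖ ^ 2 ≤ β ^ 2) →
    ‖∑ m, ∑ n, a m n * ∑ j, x m j * y n j‖ ≤ K * α * β

/-- Cauchy–Schwarz entry by entry. The bound depends on the matrix, but its finiteness is enough to
start the iteration. -/
theorem isGrothendieckBound_sum_norm (a : M → N → 𝕜) :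
    IsGrothendieckBound a (∑ m, ∑ n, ‖a m n‖) := by
  intro J _ x y α β hα hβ hx hy
  simp only [Finset.sum_mul]
  refine (norm_sum_le _ _).trans (Finset.sum_le_sum fun m _ => ?_)
  refine (norm_sum_le _ _).trans (Finset.sum_le_sum fun n _ => ?_)
  rw [norm_mul, mul_assoc]
  gcongr
  refine (norm_sum_le _ _).trans ?_
  simp only [norm_mul]
  refine abs_le_of_sq_le_sq' ?_ (by positivity) |>.2
  refine (Finset.sum_mul_sq_le_sq_mul_sq _ _ _).trans ?_
  rw [mul_pow]
  gcongr
  exacts [hx m, hy n]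

/-- Realise the vectors as functions on Ω and truncate. The bounded parts are handled pointwise by
the scalar hypothesis, at cost 6 · 6 · D. Each of the two error terms contains one factor reduced by
1/3 and is bounded by K itself, applied with index set Ω; this is why the bound is quantified over
all finite index sets. -/
theorem IsGrothendieckBound.improve {a : M → N → 𝕜} {D K : ℝ}
    (ha : ∀ (s : M → 𝕜) (t : N → 𝕜) (σ τ : ℝ), 0 < σ → 0 < τ → (∀ m, ‖s m‖ ≤ σ) →
      (∀ n, ‖t n‖ ≤ τ) → ‖∑ m, ∑ n, a m n * (s m * t n)‖ ≤ D * σ * τ)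
    (hK : IsGrothendieckBound a K) : IsGrothendieckBound a (36 * D + 2 / 3 * K) := by
  intro J _ x y α β hα hβ hx hy
  obtain ⟨Ω, _, _, G, hG, hT⟩ := exists_truncated_embedding 𝕜 J
  have hX := fun m => (hT (x m) α hα (hx m)).2
  have hY := fun n => (hT (y n) β hβ (hy n)).2
  have hYs := fun n => (hT (y n) β hβ (hy n)).1
  choose f g hfg hf hf2 hg2 using hX
  choose f' g' hfg' hf' hf2' hg2' using hY
  set c : ℝ := (Fintype.card Ω : ℝ) with hc
  have hc0 : 0 < c := by rw [hc]; exact_mod_cast Fintype.card_pos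
  have hsq : Real.sqrt c ^ 2 = c := Real.sq_sqrt hc0.le
  have hs0 : 0 < Real.sqrt c := Real.sqrt_pos.2 hc0
  -- The product is split as (f + g)(f' + g') = f f' + f g' + g (f' + g'), so that only two error
  -- terms occur and 2/3 < 1.
  have key : (c : 𝕜) * ∑ m, ∑ n, a m n * ∑ j, x m j * y n j =
      ∑ ω, ∑ m, ∑ n, a m n * (f m ω * f' n ω) +
      (∑ m, ∑ n, a m n * ∑ ω, f m ω * g' n ω + ∑ m, ∑ n, a m n * ∑ ω, g m ω * G (y n) ω) := by
    have hcomm : ∑ ω, ∑ m, ∑ n, a m n * (f m ω * f' n ω) =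
        ∑ m, ∑ n, ∑ ω, a m n * (f m ω * f' n ω) := by
      rw [Finset.sum_comm]
      exact Finset.sum_congr rfl fun m _ => Finset.sum_comm
    rw [hcomm, Finset.mul_sum, ← Finset.sum_add_distrib, ← Finset.sum_add_distrib]
    refine Finset.sum_congr rfl fun m _ => ?_
    rw [Finset.mul_sum, ← Finset.sum_add_distrib, ← Finset.sum_add_distrib]
    refine Finset.sum_congr rfl fun n _ => ?_
    rw [← Finset.mul_sum, ← mul_add, ← mul_add, mul_left_comm]
    congr 1
    rw [← Finset.sum_add_distrib, ← Finset.sum_add_distrib, hc, RCLike.ofReal_natCast, ← hG]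
    refine Finset.sum_congr rfl fun ω _ => ?_
    rw [hfg m ω, hfg' n ω]
    ring
  have b1 : ‖∑ ω, ∑ m, ∑ n, a m n * (f m ω * f' n ω)‖ ≤ c * (36 * D * α * β) := by
    refine (norm_sum_le _ _).trans ?_
    refine (Finset.sum_le_sum fun ω _ => ha (f · ω) (f' · ω) (6 * α) (6 * β) (by positivity)
      (by positivity) (hf · ω) (hf' · ω)).trans ?_
    simp only [Finset.sum_const, Finset.card_univ, nsmul_eq_mul]
    rw [← hc]
    apply le_of_eq
    ring
  have b2 : ‖∑ m, ∑ n, a m n * ∑ ω, f m ω * g' n ω‖ ≤ c * (K / 3 * α * β) := by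
    refine (hK Ω f g' (Real.sqrt c * α) (Real.sqrt c * (β / 3)) (by positivity) (by positivity)
      (fun m => ?_) (fun n => ?_)).trans (le_of_eq ?_)
    · rw [mul_pow, hsq]; exact hf2 m
    · rw [mul_pow, hsq]; exact hg2' n
    · linear_combination (K / 3 * α * β) * hsq
  have b3 : ‖∑ m, ∑ n, a m n * ∑ ω, g m ω * G (y n) ω‖ ≤ c * (K / 3 * α * β) := by
    refine (hK Ω g (fun n => G (y n)) (Real.sqrt c * (α / 3)) (Real.sqrt c * β) (by positivity)
      (by positivity) (fun m => ?_) (fun n => ?_)).trans (le_of_eq ?_)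
    · rw [mul_pow, hsq]; exact hg2 m
    · rw [mul_pow, hsq]; exact hYs n
    · linear_combination (K / 3 * α * β) * hsq
  have hn := congrArg norm key
  rw [norm_mul, RCLike.norm_ofReal, abs_of_pos hc0] at hn
  have := (norm_add_le _ _).trans (add_le_add b1 ((norm_add_le _ _).trans (add_le_add b2 b3)))
  rw [← hn] at this
  have h' : c * ‖∑ m, ∑ n, a m n * ∑ j, x m j * y n j‖ ≤
      c * ((36 * D + 2 / 3 * K) * α * β) := by linarith
  exact le_of_mul_le_mul_left h' hc0

/-- The map K ↦ 36 D + 2/3 K is a contraction with fixed point 108 D; iterating it from any finite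
bound converges there. -/
theorem isGrothendieckBound_of_forall_norm_le {a : M → N → 𝕜} {D : ℝ}
    (ha : ∀ (s : M → 𝕜) (t : N → 𝕜) (σ τ : ℝ), 0 < σ → 0 < τ → (∀ m, ‖s m‖ ≤ σ) →
      (∀ n, ‖t n‖ ≤ τ) → ‖∑ m, ∑ n, a m n * (s m * t n)‖ ≤ D * σ * τ) :
    IsGrothendieckBound a (108 * D) := by
  have h : ∀ k : ℕ, IsGrothendieckBound a
      (108 * D + (2 / 3 : ℝ) ^ k * ((∑ m, ∑ n, ‖a m n‖) - 108 * D)) := by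
    intro k
    induction k with
    | zero => simpa using isGrothendieckBound_sum_norm a
    | succ k ih =>
      have := ih.improve ha
      convert this using 1
      ring
  intro J _ x y α β hα hβ hx hy
  have hlim : Filter.Tendsto (fun k : ℕ =>
      (108 * D + (2 / 3 : ℝ) ^ k * ((∑ m, ∑ n, ‖a m n‖) - 108 * D)) * α * β) Filter.atTop
      (nhds ((108 * D + 0 * ((∑ m, ∑ n, ‖a m n‖) - 108 * D)) * α * β)) :=
    (((tendsto_pow_atTop_nhds_zero_of_lt_one (by norm_num) (by norm_num)).mul_const _).const_add
      _ |>.mul_const _).mul_const _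
  rw [zero_mul, add_zero] at hlim
  exact ge_of_tendsto' hlim fun k => h k J x y α β hα hβ hx hy

/-- **Grothendieck's inequality**. -/
theorem grothendieck_inequality {a : M → N → 𝕜} {D : ℝ}
    (ha : ∀ (s : M → 𝕜) (t : N → 𝕜) (σ τ : ℝ), 0 < σ → 0 < τ → (∀ m, ‖s m‖ ≤ σ) →
      (∀ n, ‖t n‖ ≤ τ) → ‖∑ m, ∑ n, a m n * (s m * t n)‖ ≤ D * σ * τ)
    {J : Type} [Fintype J] {x : M → J → 𝕜} {y : N → J → 𝕜} {α β : ℝ} (hα : 0 ≤ α) (hβ : 0 ≤ β)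
    (hx : ∀ m, ∑ j, ‖x m j‖ ^ 2 ≤ α ^ 2) (hy : ∀ n, ∑ j, ‖y n j‖ ^ 2 ≤ β ^ 2) :
    ‖∑ m, ∑ n, a m n * ∑ j, x m j * y n j‖ ≤ 108 * D * α * β := by
  -- Radii equal to zero are reached by enlarging α and β by 1/(k+1) and letting k tend to infinity.
  have hδ := tendsto_one_div_add_atTop_nhds_zero_nat (𝕜 := ℝ)
  have hlim := ((hδ.const_add α).const_mul (108 * D)).mul (hδ.const_add β)
  rw [add_zero, add_zero] at hlim
  refine ge_of_tendsto' hlim fun k => ?_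
  have hk : (0 : ℝ) < 1 / ((k : ℝ) + 1) := by positivity
  refine isGrothendieckBound_of_forall_norm_le ha J x y _ _ (by positivity) (by positivity)
    (fun m => (hx m).trans ?_) (fun n => (hy n).trans ?_) <;>
  · gcongr
    linarith

end Grothendieck

/-! ### Summing properties of forms and operators on 𝓛_∞ spaces -/

section SummingForms

variable {𝕜 : Type*} [RCLike 𝕜] {X Y : Type*} [NormedAddCommGroup X] [NormedSpace 𝕜 X]
  [NormedAddCommGroup Y] [NormedSpace 𝕜 Y]

/-- The weak `ℓ_p` norm of the finite family `x` is at most `w`. -/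
def WeakLpBound (𝕜 : Type*) [RCLike 𝕜] {X : Type*} [NormedAddCommGroup X] [NormedSpace 𝕜 X]
    {J : Type*} [Fintype J] (p : ℝ) (x : J → X) (w : ℝ) : Prop :=
  ∀ φ : X →L[𝕜] 𝕜, ∑ j, ‖φ (x j)‖ ^ p ≤ (w * ‖φ‖) ^ p

theorem weakLpBound_two_iff {J : Type*} [Fintype J] {x : J → X} {w : ℝ} :
    WeakLpBound 𝕜 2 x w ↔ ∀ φ : X →L[𝕜] 𝕜, ∑ j, ‖φ (x j)‖ ^ 2 ≤ (w * ‖φ‖) ^ 2 := by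
  simp only [WeakLpBound, Real.rpow_two]

/-- The span of the given vectors sits in a copy F of ℓ_∞^N. The e m are the images of the unit
vectors, and the φ m are the coordinate functionals of F, extended to X by Hahn–Banach without
increase of norm so that weak norms in X apply to them. -/
theorem IsScriptLInftyWith.exists_factorization {lam : ℝ} (h : IsScriptLInftyWith 𝕜 X lam)
    {J : Type*} [Finite J] (x : J → X) :
    ∃ (N : ℕ) (e : Fin N → X) (φ : Fin N → X →L[𝕜] 𝕜) (A B : ℝ), 0 ≤ A ∧ 0 ≤ B ∧ A * B ≤ lam ∧
      (∀ j, x j = ∑ m, φ m (x j) • e m) ∧ (∀ m, ‖φ m‖ ≤ A) ∧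
      ∀ (s : Fin N → 𝕜) (σ : ℝ), 0 ≤ σ → (∀ m, ‖s m‖ ≤ σ) → ‖∑ m, s m • e m‖ ≤ B * σ := by
  obtain ⟨F, hEF, hF, v, hv⟩ := h (Submodule.span 𝕜 (Set.range x))
    (FiniteDimensional.span_of_finite 𝕜 (Set.finite_range x))
  have hxF : ∀ j, x j ∈ F := fun j => hEF (Submodule.subset_span ⟨j, rfl⟩)
  choose φ hφ hφn using fun m => exists_extension_norm_eq F
    ((ContinuousLinearMap.proj (R := 𝕜) (φ := fun _ : Fin (Module.finrank 𝕜 F) => 𝕜) m).comp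
      (v : F →L[𝕜] (Fin (Module.finrank 𝕜 F) → 𝕜)))
  have hsum : ∀ s : Fin (Module.finrank 𝕜 F) → 𝕜,
      ∑ m, s m • ((v.symm (Pi.single m 1) : F) : X) = (v.symm s : F) := by
    intro s
    have : s = ∑ m, s m • (Pi.single m 1 : Fin (Module.finrank 𝕜 F) → 𝕜) := by
      simpa using (pi_eq_sum_univ' s)
    conv_rhs => rw [this]
    simp only [map_sum, map_smul, Submodule.coe_sum, Submodule.coe_smul]
  refine ⟨Module.finrank 𝕜 F, fun m => (v.symm (Pi.single m 1) : F), φ,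
    ‖(v : F →L[𝕜] (Fin (Module.finrank 𝕜 F) → 𝕜))‖,
    ‖(v.symm : (Fin (Module.finrank 𝕜 F) → 𝕜) →L[𝕜] F)‖, norm_nonneg _, norm_nonneg _, hv.le,
    ?_, ?_, ?_⟩
  · intro j
    have h1 : ∀ m, φ m (x j) = v ⟨x j, hxF j⟩ m := fun m => hφ m ⟨x j, hxF j⟩
    simp only [h1]
    rw [hsum, ContinuousLinearEquiv.symm_apply_apply]
  · intro m
    rw [hφn]
    refine ContinuousLinearMap.opNorm_le_bound _ (norm_nonneg _) fun z => ?_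
    exact (norm_le_pi_norm (v z) m).trans
      ((v : F →L[𝕜] (Fin (Module.finrank 𝕜 F) → 𝕜)).le_opNorm z)
  · intro s σ hσ hs
    rw [hsum]
    refine ((v.symm : (Fin (Module.finrank 𝕜 F) → 𝕜) →L[𝕜] F).le_opNorm s).trans ?_
    gcongr
    exact (pi_norm_le_iff_of_nonneg hσ).2 hs

theorem sum_sum_mul_sum_eq {R M N J : Type*} [CommSemiring R] [Fintype M] [Fintype N] [Fintype J]
    (a : M → N → R) (x : M → J → R) (y : N → J → R) :
    ∑ m, ∑ n, a m n * ∑ j, x m j * y n j = ∑ j, ∑ m, ∑ n, a m n * (x m j * y n j) := by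
  rw [Finset.sum_comm]
  simp only [Finset.mul_sum]
  rw [Finset.sum_comm]
  conv_lhs => enter [2, m]; rw [Finset.sum_comm]
  rw [Finset.sum_comm]

theorem WeakLpBound.sum_norm_sq_le {J : Type*} [Fintype J] {x : J → X} {w A : ℝ} (hw : 0 ≤ w)
    (hx : WeakLpBound 𝕜 2 x w) {φ : X →L[𝕜] 𝕜} (hφ : ‖φ‖ ≤ A) :
    ∑ j, ‖φ (x j)‖ ^ 2 ≤ (w * A) ^ 2 := by
  refine (weakLpBound_two_iff.1 hx φ).trans ?_
  gcongr

/-- Bilinear forms on `𝓛_∞` spaces are absolutely `(1;2,2)`-summing. -/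
theorem norm_sum_bilin_le {lam₁ lam₂ D : ℝ} (hX : IsScriptLInftyWith 𝕜 X lam₁)
    (hY : IsScriptLInftyWith 𝕜 Y lam₂) (hD : 0 ≤ D) (T : X →ₗ[𝕜] Y →ₗ[𝕜] 𝕜)
    (hT : ∀ x y, ‖T x y‖ ≤ D * ‖x‖ * ‖y‖) {J : Type} [Fintype J] {x : J → X} {y : J → Y}
    {w₁ w₂ : ℝ} (hw₁ : 0 ≤ w₁) (hw₂ : 0 ≤ w₂) (hx : WeakLpBound 𝕜 2 x w₁)
    (hy : WeakLpBound 𝕜 2 y w₂) :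
    ‖∑ j, T (x j) (y j)‖ ≤ 108 * D * lam₁ * lam₂ * w₁ * w₂ := by
  obtain ⟨M, e, φ, A, B, hA, hB, hAB, hxe, hφ, he⟩ := hX.exists_factorization x
  obtain ⟨N, f, ψ, A', B', hA', hB', hAB', hyf, hψ, hf⟩ := hY.exists_factorization y
  have hform : ∀ (s : Fin M → 𝕜) (t : Fin N → 𝕜),
      ∑ m, ∑ n, T (e m) (f n) * (s m * t n) = T (∑ m, s m • e m) (∑ n, t n • f n) := by
    intro s t
    simp only [map_sum, map_smul, LinearMap.sum_apply, LinearMap.smul_apply, smul_eq_mul,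
      Finset.mul_sum]
    rw [Finset.sum_comm]
    refine Finset.sum_congr rfl fun m _ => Finset.sum_congr rfl fun n _ => ?_
    ring
  -- Scalars s, t bounded by σ, τ give vectors of norm at most B σ, B' τ, whence the constant D B
  -- B'. The weak ℓ_2 norms bound the rows (φ m (x j))_j and (ψ n (y j))_j in Euclidean norm.
  have key := grothendieck_inequality (a := fun m n => T (e m) (f n)) (D := D * B * B')
    (fun s t σ τ hσ hτ hs ht => by
      rw [hform]
      refine (hT _ _).trans ?_
      calc D * ‖∑ m, s m • e m‖ * ‖∑ n, t n • f n‖ ≤ D * (B * σ) * (B' * τ) := by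
            gcongr
            exacts [he s σ hσ.le hs, hf t τ hτ.le ht]
        _ = D * B * B' * σ * τ := by ring)
    (x := fun m j => φ m (x j)) (y := fun n j => ψ n (y j)) (mul_nonneg hw₁ hA)
    (mul_nonneg hw₂ hA') (fun m => hx.sum_norm_sq_le hw₁ (hφ m))
    (fun n => hy.sum_norm_sq_le hw₂ (hψ n))
  rw [sum_sum_mul_sum_eq] at key
  simp only [hform, ← hxe, ← hyf] at key
  refine key.trans ?_
  calc 108 * (D * B * B') * (w₁ * A) * (w₂ * A') = 108 * D * w₁ * w₂ * ((A * B) * (A' * B')) := by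
        ring
    _ ≤ 108 * D * w₁ * w₂ * (lam₁ * lam₂) := by
        gcongr
        exact (mul_nonneg hA hB).trans hAB
    _ = _ := by ring

/-- The little Grothendieck theorem: operators from an `𝓛_∞` space to a Hilbert space are
absolutely `2`-summing. -/
theorem sum_sum_norm_sq_le {lam D : ℝ} (hX : IsScriptLInftyWith 𝕜 X lam) {κ : Type*} [Fintype κ]
    (u : κ → X →L[𝕜] 𝕜) (hu : ∀ x, ∑ k, ‖u k x‖ ^ 2 ≤ (D * ‖x‖) ^ 2) (hD : 0 ≤ D)
    {J : Type} [Fintype J] {x : J → X} {w : ℝ} (hw : 0 ≤ w) (hx : WeakLpBound 𝕜 2 x w) :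
    ∑ j, ∑ k, ‖u k (x j)‖ ^ 2 ≤ (11 * D * lam * w) ^ 2 := by
  obtain ⟨M, e, φ, A, B, hA, hB, hAB, hxe, hφ, he⟩ := hX.exists_factorization x
  have hform : ∀ s t : Fin M → 𝕜,
      ∑ m, ∑ n, (∑ k, u k (e m) * star (u k (e n))) * (s m * star (t n)) =
        ∑ k, u k (∑ m, s m • e m) * star (u k (∑ n, t n • e n)) := by
    intro s t
    have h := sum_sum_mul_sum_eq (fun m n => s m * star (t n)) (fun m k => u k (e m))
      (fun n k => star (u k (e n)))
    simp only [mul_comm (∑ k, _) _]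
    rw [h]
    refine Finset.sum_congr rfl fun k _ => ?_
    simp only [map_sum, map_smul, star_sum, smul_eq_mul, Finset.sum_mul_sum]
    refine Finset.sum_congr rfl fun m _ => Finset.sum_congr rfl fun n _ => ?_
    simp only [star_mul']
    ring
  -- The matrix is the Gram matrix of the vectors u(e m). Conjugating the second family turns the
  -- bilinear pairing of the inequality into the Hermitian one, so the diagonal yields ‖u(x_j)‖².
  have key := grothendieck_inequality (a := fun m n => ∑ k, u k (e m) * star (u k (e n)))
    (D := (D * B) ^ 2)
    (fun s t σ τ hσ hτ hs ht => by
      have h := hform s (star t)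
      simp only [Pi.star_apply, star_star] at h
      rw [h]
      have h1 : ∀ (r : Fin M → 𝕜) (ρ : ℝ), 0 < ρ → (∀ m, ‖r m‖ ≤ ρ) →
          ∑ k, ‖u k (∑ m, r m • e m)‖ ^ 2 ≤ (D * (B * ρ)) ^ 2 := by
        intro r ρ hρ hr
        refine (hu _).trans ?_
        gcongr
        exact he r ρ hρ.le hr
      refine (norm_sum_le _ _).trans ?_
      simp only [norm_mul, norm_star]
      refine (abs_le_of_sq_le_sq' ?_ (by positivity)).2
      refine (Finset.sum_mul_sq_le_sq_mul_sq _ _ _).trans ?_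
      calc _ ≤ (D * (B * σ)) ^ 2 * (D * (B * τ)) ^ 2 := by
            gcongr
            · exact h1 s σ hσ hs
            · exact h1 (fun n => star (t n)) τ hτ fun n => by simpa using ht n
        _ = _ := by ring)
    (x := fun m j => φ m (x j)) (y := fun n j => star (φ n (x j))) (mul_nonneg hw hA)
    (mul_nonneg hw hA) (fun m => hx.sum_norm_sq_le hw (hφ m))
    (fun n => by simpa using hx.sum_norm_sq_le hw (hφ n))
  rw [sum_sum_mul_sum_eq] at key
  simp only [hform, ← hxe] at key
  have hsq : ∀ z : 𝕜, z * star z = ((‖z‖ ^ 2 : ℝ) : 𝕜) := fun z => by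
    rw [RCLike.star_def, RCLike.mul_conj]; push_cast; rfl
  simp only [hsq, ← RCLike.ofReal_sum] at key
  rw [RCLike.norm_ofReal] at key
  refine (le_abs_self _).trans (key.trans ?_)
  -- The constant 11 comes from 108 ≤ 121 = 11².
  calc 108 * (D * B) ^ 2 * (w * A) * (w * A) = 108 * (D * w) ^ 2 * (A * B) ^ 2 := by ring
    _ ≤ 121 * (D * w) ^ 2 * lam ^ 2 := by
        gcongr
        norm_num
    _ = _ := by ring

/-- Pietsch's inclusion argument: `2`-summability of `t` along all weighted families gives
`p`-summability for `p ≥ 2`. -/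
theorem sum_rpow_le_of_forall_weights {J : Type*} [Fintype J] {x : J → X} {t : J → ℝ} {C w p : ℝ}
    (hp : 2 ≤ p) (ht : ∀ j, 0 ≤ t j) (hC : 0 ≤ C) (hw : 0 ≤ w) (hx : WeakLpBound 𝕜 p x w)
    (h : ∀ (c : J → ℝ) (W : ℝ), 0 ≤ W → WeakLpBound 𝕜 2 (fun j => (c j : 𝕜) • x j) W →
      ∑ j, (c j * t j) ^ 2 ≤ (C * W) ^ 2) :
    ∑ j, t j ^ p ≤ (C * w) ^ p := by
  rcases hp.eq_or_lt with rfl | hp2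
  · have := h (fun _ => 1) w hw (by simpa using hx)
    simpa using this
  have hp0 : 0 < p := by linarith
  set S := ∑ j, t j ^ p with hS
  have hS0 : 0 ≤ S := Finset.sum_nonneg fun j _ => Real.rpow_nonneg (ht j) _
  have hc : ∀ j, (t j ^ ((p - 2) / 2)) ^ 2 = t j ^ (p - 2) := fun j => by
    rw [← Real.rpow_two, ← Real.rpow_mul (ht j)]
    congr 1
    ring
  have hSW : (S ^ ((p - 2) / (2 * p))) ^ 2 = S ^ ((p - 2) / p) := by
    rw [← Real.rpow_two, ← Real.rpow_mul hS0]
    congr 1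
    field_simp
  have hpq : (p / (p - 2)).HolderConjugate (p / 2) := by
    rw [Real.holderConjugate_iff]
    have : p - 2 ≠ 0 := by linarith
    constructor
    · rw [lt_div_iff₀ (by linarith)]; linarith
    · field_simp
      ring
  -- The weights are chosen so that (c_j t_j)² = t_j^p. Hölder with exponents p/(p-2) and p/2 bounds
  -- the weighted weak ℓ_2 norm by a power of S; since that power is smaller than S itself, it can
  -- be divided out below.
  have hW : WeakLpBound 𝕜 2 (fun j => ((t j ^ ((p - 2) / 2) : ℝ) : 𝕜) • x j)
      (S ^ ((p - 2) / (2 * p)) * w) := by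
    rw [weakLpBound_two_iff]
    intro φ
    simp only [map_smul, norm_smul, RCLike.norm_ofReal, mul_pow, sq_abs, hc, hSW]
    refine (Real.inner_le_Lp_mul_Lq_of_nonneg _ hpq (fun j _ => Real.rpow_nonneg (ht j) _)
      (fun j _ => by positivity)).trans ?_
    have e1 : ∀ j, (t j ^ (p - 2)) ^ (p / (p - 2)) = t j ^ p := fun j => by
      rw [← Real.rpow_mul (ht j)]
      congr 1
      have : p - 2 ≠ 0 := by linarith
      field_simp
    have e2 : ∀ j, (‖φ (x j)‖ ^ 2) ^ (p / 2) = ‖φ (x j)‖ ^ p := fun j => by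
      rw [← Real.rpow_two, ← Real.rpow_mul (norm_nonneg _)]
      congr 1
      ring
    simp only [e1, e2, one_div, inv_div, ← hS]
    rw [mul_assoc]
    gcongr
    refine (Real.rpow_le_rpow (by positivity) (hx φ) (by positivity)).trans (le_of_eq ?_)
    rw [← Real.rpow_mul (by positivity), mul_div_cancel₀ _ hp0.ne', Real.rpow_two, mul_pow]
  have h1 := h _ _ (by positivity) hW
  have h2 : ∀ j, (t j ^ ((p - 2) / 2) * t j) ^ 2 = t j ^ p := fun j => by
    rcases (ht j).eq_or_lt with h0 | h0
    · rw [← h0, mul_zero, Real.zero_rpow hp0.ne']; norm_num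
    · rw [mul_pow, hc, ← Real.rpow_two, ← Real.rpow_add h0]
      congr 1
      ring
  simp only [h2, ← hS, mul_pow, hSW] at h1
  rcases hS0.eq_or_lt with h0 | h0
  · rw [← h0]; positivity
  have h3 : S ^ (2 / p) ≤ (C * w) ^ 2 := by
    have h4 : S = S ^ ((p - 2) / p) * S ^ (2 / p) := by
      rw [← Real.rpow_add h0, ← add_div, sub_add_cancel, div_self hp0.ne', Real.rpow_one]
    have h5 : 0 < S ^ ((p - 2) / p) := by positivity
    refine le_of_mul_le_mul_left ?_ h5
    rw [← h4]
    refine h1.trans (le_of_eq ?_)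
    ring
  have h6 := Real.rpow_le_rpow (by positivity) h3 (by positivity : 0 ≤ p / 2)
  rwa [← Real.rpow_two, ← Real.rpow_mul hS0, ← Real.rpow_mul (by positivity), div_mul_div_comm,
    mul_comm 2 p, div_self (by positivity), Real.rpow_one, mul_div_cancel₀ _ two_ne_zero] at h6

theorem sum_sqrt_sum_norm_sq_rpow_le {lam D p : ℝ} (hp : 2 ≤ p) (hlam : 0 ≤ lam)
    (hX : IsScriptLInftyWith 𝕜 X lam) {κ : Type*} [Fintype κ]
    (u : κ → X →L[𝕜] 𝕜) (hu : ∀ x, ∑ k, ‖u k x‖ ^ 2 ≤ (D * ‖x‖) ^ 2) (hD : 0 ≤ D)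
    {J : Type} [Fintype J] {x : J → X} {w : ℝ} (hw : 0 ≤ w) (hx : WeakLpBound 𝕜 p x w) :
    ∑ j, Real.sqrt (∑ k, ‖u k (x j)‖ ^ 2) ^ p ≤ (11 * D * lam * w) ^ p := by
  refine sum_rpow_le_of_forall_weights hp (fun j => Real.sqrt_nonneg _) (by positivity) hw hx
    fun c W hW hcx => ?_
  refine le_trans (le_of_eq (Finset.sum_congr rfl fun j _ => ?_))
    (sum_sum_norm_sq_le hX u hu hD hW hcx)
  rw [mul_pow, Real.sq_sqrt (by positivity), Finset.mul_sum]
  refine Finset.sum_congr rfl fun k _ => ?_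
  rw [map_smul, norm_smul, RCLike.norm_ofReal, mul_pow, sq_abs]

/-- By Pietsch's argument it suffices to treat p = 2. There a duality trick applies: an ℓ_2 scalar
sequence times a bounded vector sequence is weakly 2-summable, so boundedness of y is all that is
needed. -/
theorem sum_norm_bilin_rpow_le {lam₁ lam₂ D p b : ℝ} (hp : 2 ≤ p) (h₁ : 0 ≤ lam₁) (h₂ : 0 ≤ lam₂)
    (hX : IsScriptLInftyWith 𝕜 X lam₁)
    (hY : IsScriptLInftyWith 𝕜 Y lam₂) (hD : 0 ≤ D) (T : X →ₗ[𝕜] Y →ₗ[𝕜] 𝕜)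
    (hT : ∀ x y, ‖T x y‖ ≤ D * ‖x‖ * ‖y‖) {J : Type} [Fintype J] {x : J → X} {y : J → Y}
    {w : ℝ} (hw : 0 ≤ w) (hb : 0 ≤ b) (hx : WeakLpBound 𝕜 p x w) (hy : ∀ j, ‖y j‖ ≤ b) :
    ∑ j, ‖T (x j) (y j)‖ ^ p ≤ (108 * D * lam₁ * lam₂ * b * w) ^ p := by
  refine sum_rpow_le_of_forall_weights hp (fun j => norm_nonneg _) (by positivity) hw hx
    fun c W hW hcx => ?_
  set x' : J → X := fun j => (c j : 𝕜) • x j with hx'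
  set S := ∑ j, ‖T (x' j) (y j)‖ ^ 2 with hS
  have hS0 : 0 ≤ S := by positivity
  have hSe : ∑ j, (c j * ‖T (x j) (y j)‖) ^ 2 = S := by
    refine Finset.sum_congr rfl fun j _ => ?_
    rw [hx', map_smul, LinearMap.smul_apply, norm_smul, RCLike.norm_ofReal, mul_pow, mul_pow,
      sq_abs]
  -- With these multiples of y_j, ∑ T(x'_j, ·) equals S, while its bound is proportional to √S;
  -- cancelling √S gives the estimate.
  have hy' : WeakLpBound 𝕜 2 (fun j => star (T (x' j) (y j)) • y j) (Real.sqrt S * b) := by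
    rw [weakLpBound_two_iff]
    intro ψ
    simp only [mul_pow, Real.sq_sqrt hS0]
    rw [hS, Finset.sum_mul, Finset.sum_mul]
    refine Finset.sum_le_sum fun j _ => ?_
    rw [map_smul, norm_smul, norm_star, mul_pow, mul_assoc, ← mul_pow b]
    gcongr
    refine (ψ.le_opNorm _).trans ?_
    rw [mul_comm]
    gcongr
    exact hy j
  have key := norm_sum_bilin_le hX hY hD T hT hW (by positivity) hcx hy'
  have hsq : ∀ z : 𝕜, star z * z = ((‖z‖ ^ 2 : ℝ) : 𝕜) := fun z => by
    rw [RCLike.star_def, RCLike.conj_mul]; push_cast; rfl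
  simp only [map_smul, smul_eq_mul, hsq, ← RCLike.ofReal_sum] at key
  rw [RCLike.norm_ofReal, ← hS, abs_of_nonneg hS0] at key
  rw [hSe]
  set c' := 108 * D * lam₁ * lam₂ * b * W with hc'
  have hc0 : 0 ≤ c' := by positivity
  have h1 : Real.sqrt S * Real.sqrt S ≤ c' * Real.sqrt S := by
    rw [Real.mul_self_sqrt hS0]
    refine key.trans (le_of_eq ?_)
    rw [hc']
    ring
  have h2 : Real.sqrt S ≤ c' := by
    rcases (Real.sqrt_nonneg S).eq_or_lt with h0 | h0
    · rwa [← h0]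
    · exact le_of_mul_le_mul_right h1 h0
  calc S = Real.sqrt S ^ 2 := (Real.sq_sqrt hS0).symm
    _ ≤ c' ^ 2 := by gcongr

end SummingForms

/-! ### Uniform bounds for weakly summable sequences -/

section WeaklySummable

variable {𝕜 : Type*} [RCLike 𝕜] {X : Type*} [NormedAddCommGroup X] [NormedSpace 𝕜 X]

/-- The map φ ↦ (φ(x_j))_j from the dual to ℓ_q has closed graph, since convergence in ℓ_q implies
coordinatewise convergence; its operator norm serves as w. -/
theorem IsWeaklySummable.exists_weakLpBound {q : ℝ≥0∞} (hq : 1 ≤ q) (hq' : q ≠ ∞) {x : ℕ → X}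
    (h : IsWeaklySummable 𝕜 q x) :
    ∃ w : ℝ, 0 ≤ w ∧ ∀ s : Finset ℕ, WeakLpBound 𝕜 q.toReal (fun j : s => x j) w := by
  have : Fact (1 ≤ q) := ⟨hq⟩
  have hq0 : 0 < q.toReal := ENNReal.toReal_pos (zero_lt_one.trans_le hq).ne' hq'
  let g : (X →L[𝕜] 𝕜) →ₗ[𝕜] lp (fun _ : ℕ => 𝕜) q :=
    { toFun := fun φ => ⟨fun j => φ (x j), h φ⟩
      map_add' := fun _ _ => rfl
      map_smul' := fun _ _ => rfl }
  have hg : ∀ φ j, g φ j = φ (x j) := fun _ _ => rfl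
  have hcont : Continuous g := by
    refine g.continuous_of_seq_closed_graph fun φ ψ y hφ hy => lp.ext (funext fun j => ?_)
    have h1 : Filter.Tendsto (fun n => g (φ n) j) Filter.atTop (nhds (y j)) := by
      rw [tendsto_iff_norm_sub_tendsto_zero] at hy ⊢
      refine squeeze_zero (fun _ => norm_nonneg _) (fun n => ?_) hy
      exact lp.norm_apply_le_norm (zero_lt_one.trans_le hq).ne' (g (φ n) - y) j
    have h2 : Filter.Tendsto (fun n => g (φ n) j) Filter.atTop (nhds (g ψ j)) :=
      ((ContinuousLinearMap.apply 𝕜 𝕜 (x j)).continuous.tendsto ψ).comp hφ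
    exact tendsto_nhds_unique h1 h2
  let G : (X →L[𝕜] 𝕜) →L[𝕜] lp (fun _ : ℕ => 𝕜) q := ⟨g, hcont⟩
  refine ⟨‖G‖, G.opNorm_nonneg, fun s φ => ?_⟩
  rw [Finset.sum_coe_sort s fun j => ‖φ (x j)‖ ^ q.toReal]
  refine (lp.sum_rpow_le_norm_rpow hq0 (G φ) s).trans ?_
  gcongr
  exact G.le_opNorm φ

theorem IsWeaklySummable.exists_norm_le {q : ℝ≥0∞} {x : ℕ → X} (h : IsWeaklySummable 𝕜 q x) :
    ∃ b : ℝ, 0 ≤ b ∧ ∀ j, ‖x j‖ ≤ b := by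
  obtain ⟨C, hC⟩ := banach_steinhaus (g := fun j => NormedSpace.inclusionInDoubleDualLi 𝕜 (x j))
    fun φ => by
      obtain ⟨C, hC⟩ := ((h φ).of_exponent_ge le_top).bddAbove
      exact ⟨C, fun j => hC ⟨j, rfl⟩⟩
  simp only [LinearIsometry.norm_map] at hC
  exact ⟨C, (norm_nonneg _).trans (hC 0), hC⟩

/-- Adjoining the base point as the index `none` lets one multi-indexed sum contain both the moving
and the fixed slots. -/
theorem WeakLpBound.option_elim {J : Type*} [Fintype J] {x : J → X} {w : ℝ} (hw : 0 ≤ w)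
    (h : WeakLpBound 𝕜 2 x w) (a : X) :
    WeakLpBound 𝕜 2 (fun o : Option J => o.elim a x) (‖a‖ + w) := by
  rw [weakLpBound_two_iff] at h ⊢
  intro φ
  rw [Fintype.sum_option]
  have h1 : ‖φ a‖ ^ 2 ≤ (‖φ‖ * ‖a‖) ^ 2 := by
    gcongr
    exact φ.le_opNorm a
  have h2 : 0 ≤ ‖a‖ * w * ‖φ‖ ^ 2 := by positivity
  have h3 := h φ
  simp only [Option.elim]
  nlinarith

end WeaklySummable

/-! ### Multilinear forms and reduction to mixed terms -/

section Multilinear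

variable {𝕜 : Type*} [RCLike 𝕜]

/-- Multilinear forms on `𝓛_∞` spaces are multiple `2`-summing. -/
theorem sum_norm_sq_multilinear_le {n : ℕ} {X : Fin n → Type*}
    [∀ i, NormedAddCommGroup (X i)] [∀ i, NormedSpace 𝕜 (X i)] {lam w : Fin n → ℝ}
    (hlam : ∀ i, 0 ≤ lam i) (hX : ∀ i, IsScriptLInftyWith 𝕜 (X i) (lam i)) {J : Type} [Fintype J]
    {x : ∀ i, J → X i} (hw : ∀ i, 0 ≤ w i) (hx : ∀ i, WeakLpBound 𝕜 2 (x i) (w i))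
    (T : ContinuousMultilinearMap 𝕜 X 𝕜) :
    ∑ k : Fin n → J, ‖T fun i => x i (k i)‖ ^ 2 ≤ (‖T‖ * ∏ i, 11 * lam i * w i) ^ 2 := by
  induction n with
  | zero =>
    simp only [Finset.univ_unique, Finset.sum_singleton, Finset.univ_eq_empty, Finset.prod_empty]
    gcongr
    simpa using T.le_opNorm fun i => x i ((default : Fin 0 → J) i)
  | succ n ih =>
    have hcons : ∀ (j : J) (k : Fin n → J), (fun i => x i (Fin.cons (α := fun _ => J) j k i)) =
        Fin.cons (x 0 j) (fun i : Fin n => x i.succ (k i)) := by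
      intro j k
      funext i
      refine Fin.cases ?_ (fun i => ?_) i <;> simp
    have hsum : ∑ k : Fin (n + 1) → J, ‖T fun i => x i (k i)‖ ^ 2 =
        ∑ j, ∑ k : Fin n → J,
          ‖T.curryLeft.flipMultilinear (fun i : Fin n => x i.succ (k i)) (x 0 j)‖ ^ 2 := by
      rw [← (Fin.consEquiv fun _ => J).sum_comp, Fintype.sum_prod_type]
      refine Finset.sum_congr rfl fun j _ => Finset.sum_congr rfl fun k _ => ?_
      rw [ContinuousLinearMap.flipMultilinear_apply_apply, ContinuousMultilinearMap.curryLeft_apply,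
        ← hcons]
      rfl
    have hD : 0 ≤ ∏ i : Fin n, 11 * lam i.succ * w i.succ := Finset.prod_nonneg fun i _ =>
      mul_nonneg (mul_nonneg (by norm_num) (hlam _)) (hw _)
    rw [hsum]
    -- By the induction hypothesis, z ↦ (T(z, x_k))_k is a bounded operator from the first space
    -- into ℓ_2 over the multi-indices k, so the little Grothendieck theorem sums over the first
    -- slot.
    refine (sum_sum_norm_sq_le (hX 0)
      (fun k : Fin n → J => T.curryLeft.flipMultilinear fun i : Fin n => x i.succ (k i))
      (D := ‖T‖ * ∏ i : Fin n, 11 * lam i.succ * w i.succ) (fun z => ?_) (by positivity) (hw 0)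
      (hx 0)).trans (le_of_eq ?_)
    · refine (ih (fun i => hlam i.succ) (fun i => hX i.succ) (fun i => hw i.succ)
        (fun i => hx i.succ) (T.curryLeft z)).trans ?_
      have h1 := T.curryLeft.le_opNorm z
      rw [ContinuousMultilinearMap.curryLeft_norm] at h1
      rw [mul_right_comm]
      gcongr
    · rw [Fin.prod_univ_succ]
      ring

theorem sum_norm_sq_curryRight_le {m : ℕ} {X : Fin (m + 1) → Type*}
    [∀ i, NormedAddCommGroup (X i)] [∀ i, NormedSpace 𝕜 (X i)] {lam w : Fin m → ℝ}
    (hlam : ∀ i, 0 ≤ lam i) (hX : ∀ i : Fin m, IsScriptLInftyWith 𝕜 (X i.castSucc) (lam i))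
    {J : Type} [Fintype J] {x : ∀ i : Fin m, J → X i.castSucc} (hw : ∀ i, 0 ≤ w i)
    (hx : ∀ i, WeakLpBound 𝕜 2 (x i) (w i)) (T : ContinuousMultilinearMap 𝕜 X 𝕜)
    (z : X (Fin.last m)) :
    ∑ k : Fin m → J, ‖T.curryRight (fun i => x i (k i)) z‖ ^ 2 ≤
      (‖T‖ * (∏ i, 11 * lam i * w i) * ‖z‖) ^ 2 := by
  let f : ContinuousMultilinearMap 𝕜 (fun i : Fin m => X i.castSucc) 𝕜 :=
    (ContinuousLinearMap.apply 𝕜 𝕜 z).compContinuousMultilinearMap T.curryRight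
  have hf : ‖f‖ ≤ ‖T‖ * ‖z‖ := by
    refine ContinuousMultilinearMap.opNorm_le_bound (by positivity) fun y => ?_
    refine ((T.curryRight y).le_opNorm z).trans ?_
    rw [mul_right_comm]
    gcongr
    have := T.curryRight.le_opNorm y
    rwa [ContinuousMultilinearMap.curryRight_norm] at this
  have hP : 0 ≤ ∏ i, 11 * lam i * w i := Finset.prod_nonneg fun i _ =>
    mul_nonneg (mul_nonneg (by norm_num) (hlam _)) (hw _)
  refine (sum_norm_sq_multilinear_le hlam hX hw hx f).trans ?_
  rw [mul_right_comm]
  gcongr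

theorem isAbsSummingAt_of_forall_piecewise {ι : Type*} [Fintype ι] [DecidableEq ι]
    {E : ι → Type*} [∀ i, NormedAddCommGroup (E i)] [∀ i, NormedSpace 𝕜 (E i)]
    {F : Type*} [NormedAddCommGroup F] [NormedSpace 𝕜 F] {p : ℝ≥0∞} {q : ι → ℝ≥0∞}
    {T : ContinuousMultilinearMap 𝕜 E F} {a : ∀ i, E i}
    (h : ∀ x : (i : ι) → ℕ → E i, (∀ i, IsWeaklySummable 𝕜 (q i) (x i)) →
      ∀ S : Finset ι, S.Nonempty →
        Memℓp (E := fun _ : ℕ => F) (fun j => T (S.piecewise (fun i => x i j) a)) p) :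
    IsAbsSummingAt p q T a := by
  intro x hx
  have hexp : (fun j => T (fun i => a i + x i j) - T a) =
      fun j => ∑ S ∈ (Finset.univ : Finset (Finset ι)).erase ∅, T (S.piecewise (fun i => x i j) a) := by
    funext j
    have h1 := T.toMultilinearMap.map_add_univ (fun i => x i j) a
    rw [← Finset.add_sum_erase _ _ (Finset.mem_univ ∅), Finset.piecewise_empty] at h1
    have h2 : (fun i => a i + x i j) = (fun i => x i j) + a := by
      funext i
      exact add_comm _ _
    rw [h2, sub_eq_iff_eq_add']
    exact h1
  rw [hexp]
  exact Memℓp.finsetSum _ fun S hS => h x hx S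
    (Finset.nonempty_iff_ne_empty.2 (Finset.ne_of_mem_erase hS))

theorem isAbsSummingAt_top {ι : Type*} [Fintype ι] {E : ι → Type*}
    [∀ i, NormedAddCommGroup (E i)] [∀ i, NormedSpace 𝕜 (E i)]
    {F : Type*} [NormedAddCommGroup F] [NormedSpace 𝕜 F] (q : ι → ℝ≥0∞)
    (T : ContinuousMultilinearMap 𝕜 E F) (a : ∀ i, E i) : IsAbsSummingAt ∞ q T a := by
  intro x hx
  choose b hb hxb using fun i => (hx i).exists_norm_le
  refine memℓp_infty ⟨‖T‖ * ∏ i, (‖a i‖ + b i) + ‖T a‖, ?_⟩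
  rintro _ ⟨j, rfl⟩
  refine (norm_sub_le _ _).trans ?_
  gcongr
  refine (T.le_opNorm _).trans ?_
  gcongr with i
  exact (norm_add_le _ _).trans (by gcongr; exact hxb i j)

theorem memℓp_bilinear_piecewise {X : Fin 2 → Type*}
    [∀ i, NormedAddCommGroup (X i)] [∀ i, NormedSpace 𝕜 (X i)]
    (hX : ∀ i, IsScriptLInfty 𝕜 (X i)) (T : ContinuousMultilinearMap 𝕜 X 𝕜) {r : ℝ≥0∞}
    (hr : 2 ≤ r) (hr' : r ≠ ∞) (a : ∀ i, X i) {x : (i : Fin 2) → ℕ → X i}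
    (hx : ∀ i, IsWeaklySummable 𝕜 r (x i)) (S : Finset (Fin 2)) (hS : S.Nonempty) :
    Memℓp (E := fun _ : ℕ => 𝕜) (fun j => T (S.piecewise (fun i => x i j) a)) r := by
  obtain ⟨i, hi⟩ := hS
  obtain ⟨i', hne⟩ := exists_ne i
  replace hne := hne.symm
  choose lam hlam hX using hX
  have hlam0 : ∀ i, 0 ≤ lam i := fun i => zero_le_one.trans (hlam i).le
  have hrr : 2 ≤ r.toReal := by
    have := ENNReal.toReal_mono hr' hr
    simpa using this
  obtain ⟨w, hw, hwx⟩ := (hx i).exists_weakLpBound (le_trans (by norm_num) hr) hr'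
  obtain ⟨b, hb, hbx⟩ := (hx i').exists_norm_le
  let B : X i →ₗ[𝕜] X i' →ₗ[𝕜] 𝕜 := LinearMap.mk₂ 𝕜
    (fun u v => T (Function.update (Function.update a i u) i' v))
    (fun u u' v => by simp only [Function.update_comm hne, T.map_update_add])
    (fun c u v => by simp only [Function.update_comm hne, T.map_update_smul])
    (fun u v v' => T.map_update_add _ _ _ _)
    (fun c u v => T.map_update_smul _ _ _ _)
  have hBT : ∀ u v, B u v = T (Function.update (Function.update a i u) i' v) := fun _ _ => rfl
  have huniv : (Finset.univ : Finset (Fin 2)) = {i, i'} :=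
    (by decide : ∀ i i' : Fin 2, i ≠ i' → (Finset.univ : Finset (Fin 2)) = {i, i'}) i i' hne
  have hB : ∀ u v, ‖B u v‖ ≤ ‖T‖ * ‖u‖ * ‖v‖ := by
    intro u v
    rw [hBT]
    refine (T.le_opNorm _).trans (le_of_eq ?_)
    rw [huniv, Finset.prod_pair hne, Function.update_self, Function.update_of_ne hne,
      Function.update_self, mul_assoc]
  -- Whether the other slot moves or stays at the base point, y is bounded, and nothing more is
  -- required of it.
  let y : ℕ → X i' := fun j => S.piecewise (fun i => x i j) a i'
  have hy : ∀ j, ‖y j‖ ≤ ‖a i'‖ + b := by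
    intro j
    by_cases h : i' ∈ S
    · simp only [y, Finset.piecewise_eq_of_mem _ _ _ h]
      linarith [hbx j, norm_nonneg (a i')]
    · simp only [y, Finset.piecewise_eq_of_notMem _ _ _ h]
      linarith
  have hTB : ∀ j, T (S.piecewise (fun i => x i j) a) = B (x i j) (y j) := by
    intro j
    rw [hBT]
    congr 1
    funext l
    have hl : l = i ∨ l = i' := by
      have := Finset.mem_univ l
      rw [huniv] at this
      simpa using this
    rcases hl with rfl | rfl
    · rw [Function.update_of_ne hne, Function.update_self, Finset.piecewise_eq_of_mem _ _ _ hi]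
    · rw [Function.update_self]
  refine memℓp_gen' (C := (108 * ‖T‖ * lam i * lam i' * (‖a i'‖ + b) * w) ^ r.toReal) fun s => ?_
  simp only [hTB]
  rw [← Finset.sum_coe_sort s fun j => ‖B (x i j) (y j)‖ ^ r.toReal]
  exact sum_norm_bilin_rpow_le hrr (hlam0 i) (hlam0 i') (hX i) (hX i') (norm_nonneg _) B hB hw
    (by positivity) (hwx s) fun j => hy j

theorem memℓp_multilinear_piecewise {m : ℕ} {X : Fin (m + 1) → Type*}
    [∀ i, NormedAddCommGroup (X i)] [∀ i, NormedSpace 𝕜 (X i)]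
    (hX : ∀ i, IsScriptLInfty 𝕜 (X i)) (T : ContinuousMultilinearMap 𝕜 X 𝕜) {r : ℝ≥0∞}
    (hr : 2 ≤ r) (hr' : r ≠ ∞) (a : ∀ i, X i) {x : (i : Fin (m + 1)) → ℕ → X i}
    (hx : ∀ i : Fin m, IsWeaklySummable 𝕜 2 (x i.castSucc))
    (hxl : IsWeaklySummable 𝕜 r (x (Fin.last m))) (S : Finset (Fin (m + 1))) (hS : S.Nonempty) :
    Memℓp (E := fun _ : ℕ => 𝕜) (fun j => T (S.piecewise (fun i => x i j) a)) r := by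
  choose lam hlam hX using hX
  have hlam0 : ∀ i, 0 ≤ lam i := fun i => zero_le_one.trans (hlam i).le
  have hrr : 2 ≤ r.toReal := by
    have := ENNReal.toReal_mono hr' hr
    simpa using this
  choose w hw hwx using fun i => (hx i).exists_weakLpBound (by norm_num) (by norm_num)
  simp only [ENNReal.toReal_ofNat] at hwx
  obtain ⟨v, hv, hvx⟩ := hxl.exists_weakLpBound (le_trans (by norm_num) hr) hr'
  set P : ℝ := ∏ i : Fin m, 11 * lam i.castSucc * (‖a i.castSucc‖ + w i) with hP
  have hP0 : 0 ≤ P := Finset.prod_nonneg fun i _ => mul_nonneg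
    (mul_nonneg (by norm_num) (hlam0 _)) (add_nonneg (norm_nonneg _) (hw i))
  -- These are the coordinates of an operator into ℓ_2 whose norm is at most ‖T‖ P, independently of
  -- s.
  let u : ∀ s : Finset ℕ, (Fin m → Option s) → X (Fin.last m) →L[𝕜] 𝕜 := fun s k =>
    T.curryRight fun i => (k i).elim (a i.castSucc) fun j => x i.castSucc j
  have hu : ∀ (s : Finset ℕ) (z : X (Fin.last m)), ∑ k, ‖u s k z‖ ^ 2 ≤ (‖T‖ * P * ‖z‖) ^ 2 := by
    intro s z
    exact sum_norm_sq_curryRight_le (fun i => hlam0 i.castSucc)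
      (fun i => hX i.castSucc) (fun i => add_nonneg (norm_nonneg _) (hw i))
      (fun i => (hwx i s).option_elim (hw i) (a i.castSucc)) T z
  let k : ∀ s : Finset ℕ, s → Fin m → Option s := fun s j i =>
    if i.castSucc ∈ S then some j else none
  have huT : ∀ (s : Finset ℕ) (j : s), T (S.piecewise (fun i => x i j) a) =
      u s (k s j) (S.piecewise (fun i => x i j) a (Fin.last m)) := by
    intro s j
    simp only [u, ContinuousMultilinearMap.curryRight_apply]
    congr 1
    funext i
    refine Fin.lastCases ?_ (fun i => ?_) i
    · rw [Fin.snoc_last]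
    · rw [Fin.snoc_castSucc]
      by_cases h : i.castSucc ∈ S
      · simp [k, h]
      · simp [k, h]
  -- Last slot moving: each term is one coordinate of u(x_j), hence at most its ℓ_2 norm, and these
  -- norms are r-summable.
  by_cases hl : Fin.last m ∈ S
  · refine memℓp_gen' (C := (11 * (‖T‖ * P) * lam (Fin.last m) * v) ^ r.toReal) fun s => ?_
    rw [← Finset.sum_coe_sort s fun j => ‖T (S.piecewise (fun i => x i j) a)‖ ^ r.toReal]
    refine le_trans (Finset.sum_le_sum fun j _ => ?_)
      (sum_sqrt_sum_norm_sq_rpow_le hrr (hlam0 _) (hX (Fin.last m)) (u s) (hu s) (by positivity)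
        hv (hvx s))
    rw [huT, Finset.piecewise_eq_of_mem _ _ _ hl]
    gcongr
    refine Real.le_sqrt_of_sq_le ?_
    exact Finset.single_le_sum (f := fun k' => ‖u s k' (x (Fin.last m) j)‖ ^ 2)
      (fun _ _ => by positivity) (Finset.mem_univ (k s j))
  -- Last slot fixed: some earlier slot lies in S, so distinct j give distinct multi-indices, and
  -- the sum of squares is part of the single sum ‖u(a)‖². This gives ℓ_2, hence ℓ_r.
  · refine Memℓp.of_exponent_ge (q := 2) ?_ hr
    refine memℓp_gen' (C := (‖T‖ * P * ‖a (Fin.last m)‖) ^ 2) fun s => ?_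
    rw [← Finset.sum_coe_sort s
      fun j => ‖T (S.piecewise (fun i => x i j) a)‖ ^ (2 : ℝ≥0∞).toReal]
    have hinj : Function.Injective (k s) := by
      obtain ⟨i, hi⟩ := hS
      obtain ⟨i, rfl⟩ := Fin.exists_castSucc_eq.2 fun h : i = Fin.last m => hl (h ▸ hi)
      intro j j' hjj
      have := congrFun hjj i
      simpa [k, hi] using this
    refine le_trans (le_of_eq ?_) ((Finset.sum_le_univ_sum_of_nonneg
      (s := Finset.univ.map ⟨k s, hinj⟩) fun _ => by positivity).trans (hu s (a (Fin.last m))))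
    rw [Finset.sum_map]
    refine Finset.sum_congr rfl fun j _ => ?_
    rw [huT, Finset.piecewise_eq_of_notMem _ _ _ hl, ENNReal.toReal_ofNat, Real.rpow_two]
    rfl

end Multilinear

theorem mainTheorem9 {𝕜 : Type*} [RCLike 𝕜] (n : ℕ) (X : Fin n → Type*)
    [∀ i, NormedAddCommGroup (X i)] [∀ i, NormedSpace 𝕜 (X i)] [∀ i, CompleteSpace (X i)]
    (hX : ∀ i, IsScriptLInfty 𝕜 (X i)) (T : ContinuousMultilinearMap 𝕜 X 𝕜) :
    (n = 2 → ∀ r : ℝ≥0∞, 2 ≤ r → ∀ a : (i : Fin n) → X i,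
      IsAbsSummingAt r (fun _ => r) T a) ∧
    (3 ≤ n → ∀ r : ℝ≥0∞, 2 ≤ r → ∀ a : (i : Fin n) → X i,
      IsAbsSummingAt r (fun i : Fin n => if (i : ℕ) + 1 = n then r else 2) T a) := by
  refine ⟨?_, ?_⟩
  · rintro rfl r hr a
    rcases eq_or_ne r ∞ with rfl | hr'
    · exact isAbsSummingAt_top _ T a
    · exact isAbsSummingAt_of_forall_piecewise fun x hx S hS =>
        memℓp_bilinear_piecewise hX T hr hr' a hx S hS
  · intro hn r hr a
    rcases eq_or_ne r ∞ with rfl | hr'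
    · exact isAbsSummingAt_top _ T a
    · obtain ⟨m, rfl⟩ : ∃ m, n = m + 1 := ⟨n - 1, by omega⟩
      refine isAbsSummingAt_of_forall_piecewise fun x hx S hS =>
        memℓp_multilinear_piecewise hX T hr hr' a (fun i => ?_) ?_ S hS
      · have h := hx i.castSucc
        rwa [if_neg (by simpa using i.isLt.ne)] at h
      · have h := hx (Fin.last m)
        rwa [if_pos (by simp)] at h
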